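/- Every totally bounded Baire abelian group is a Mackey group. In detail, let $\mathbb{T}=\mathbb{R}/\mathbb{Z}$ and $\mathbb{T}_+=[-1/4,1/4]+\mathbb{Z}\subseteq\mathbb{T}$. For an abelian topological group $(G,\tau)$ let $\widehat{G}$ denote the group of all continuous homomorphisms $G\to\mathbb{T}$ (continuous characters). A set $A\subseteq G$ is quasi-convex if for every $x\in G\setminus A$ there is $\chi\in\widehat{G}$ with $\chi(A)\subseteq\mathbb{T}_+$ and $\chi(x)\notin\mathbb{T}_+$, and $(G,\tau)$ is locally quasi-convex if it has a neighbourhood base at $0$ consisting of quasi-convex sets. Let $(G,\tau)$ be a Hausdorff abelian topological group which is totally bounded (for every nonempty open $U\subseteq G$ there is a finite $F\subseteq G$ with $F+U=G$) and is a Baire space (every countable intersection of dense open subsets is dense). Then $(G,\tau)$ is a Mackey group, that is: 1. $(G,\tau)$ is Hausdorff and locally quasi-convex, and the evaluation pairing $G\times\widehat{G}\to\mathbb{T}$, $(g,\chi)\mapsto\chi(g)$, is a duality (nondegenerate on both sides); 2. $\tau$ is the finest among all locally quasi-convex group topologies $\sigma$ on $G$ that are compatible with this duality, where $\sigma$ is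 compatible if the $\sigma$-continuous homomorphisms $G\to\mathbb{T}$ are exactly the elements of $\widehat{G}$ (and $\tau$ is itself one of these topologies). -/

import Mathlib

open Topology Pointwise

/-- A topological group `G` is precompact if for every nonempty open set `U` there is a finite set
`F` with `F + U = G`. (A totally bounded group is a precompact Hausdorff group.) -/
def IsPrecompactGroup (G : Type*) [AddCommGroup G] [TopologicalSpace G] : Prop :=
  ∀ U : Set G, IsOpen U → U.Nonempty → ∃ F : Set G, F.Finite ∧ F + U = Set.univ

/-- A subset `A` of an abelian topological group is quasi-convex if every point `x ∉ A` is separated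
from `A` by a continuous character `χ : G → 𝕋 = ℝ/ℤ`, in the sense that
`χ(A) ⊆ 𝕋₊` and `χ(x) ∉ 𝕋₊`, where `𝕋₊` is the image of `[-1/4, 1/4]`, that is,
the set of all `t` at distance at most `1/4` from `0`. -/
def IsQuasiConvex {G : Type*} [AddCommGroup G] [TopologicalSpace G] (A : Set G) : Prop :=
  ∀ x, x ∉ A → ∃ χ : G →ₜ+ UnitAddCircle, (∀ a ∈ A, ‖χ a‖ ≤ 1 / 4) ∧ 1 / 4 < ‖χ x‖

/-- A topology on an abelian group is locally quasi-convex if the quasi-convex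
neighbourhoods of `0` form a neighbourhood base at `0`. -/
def IsLocallyQuasiConvex (G : Type*) [AddCommGroup G] [TopologicalSpace G] : Prop :=
  ∀ U ∈ 𝓝 (0 : G), ∃ V ∈ 𝓝 (0 : G), V ⊆ U ∧ IsQuasiConvex V

/-- A biadditive map `⟨·,·⟩ : G × G' → 𝕋` puts `G` and `G'` in duality if it is
nondegenerate on both sides. -/
structure IsGroupDuality {G G' : Type*} [AddCommGroup G] [AddCommGroup G']
    (B : G →+ G' →+ UnitAddCircle) : Prop where
  left : ∀ g : G, g ≠ 0 → ∃ g' : G', B g g' ≠ 0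
  right : ∀ g' : G', g' ≠ 0 → ∃ g : G, B g g' ≠ 0

/-- A topology `t` on `G` is compatible with a pairing of `G` and `G'` if the dual group of `(G, t)`
is `G'` through the pairing: the `t`-continuous characters of `G` are exactly
the homomorphisms `⟨·, g'⟩` with `g' ∈ G'`. -/
def IsCompatibleTopology {G G' : Type*} [AddCommGroup G] [AddCommGroup G']
    (B : G →+ G' →+ UnitAddCircle) (t : TopologicalSpace G) : Prop :=
  ∀ χ : G →+ UnitAddCircle, Continuous[t, inferInstance] χ ↔ ∃ g' : G', ∀ g : G, χ g = B g g'

/-- The evaluation pairing `(g, χ) ↦ χ(g)` between an abelian topological group `G` and its group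
`Ĝ` of continuous characters. -/
def evalPairing (G : Type*) [AddCommGroup G] [TopologicalSpace G] :
    G →+ (G →ₜ+ UnitAddCircle) →+ UnitAddCircle where
  toFun g :=
    { toFun := fun χ => χ g
      map_zero' := rfl
      map_add' := fun _ _ => rfl }
  map_zero' := by ext χ; exact map_zero χ
  map_add' g h := by ext χ; exact map_add χ g h

/-- `G` is a Mackey group if it is Hausdorff and locally quasi-convex and its topology is the finest
one among the locally quasi-convex group topologies on `G` that are compatible with the
duality between `G` and `Ĝ`. In Mathlib's order on group topologies, `s ≤ t` means that `s` is
finer than `t`, so that the finest element of a set of topologies is its least element. -/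
structure IsMackeyGroup (G : Type*) [AddCommGroup G] [T : TopologicalSpace G]
    [IsTopologicalAddGroup G] : Prop where
  hausdorff : T2Space G
  locallyQuasiConvex : IsLocallyQuasiConvex G
  duality : IsGroupDuality (evalPairing G)
  finest : IsLeast
    {t : AddGroupTopology G | IsCompatibleTopology (evalPairing G) t.toTopologicalSpace ∧
      @IsLocallyQuasiConvex G _ t.toTopologicalSpace}
    { toTopologicalSpace := T, toIsTopologicalAddGroup := inferInstance }

/-! Let `V` be a quasi-convex neighbourhood of zero for a compatible topology `t`. Homomorphisms
bounded by 1/4 on `V` are `t`-continuous, hence continuous for the given topology, and they form a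
pointwise compact set, the polar of `V`. That set is finite (`finite_of_compact_characters`), and by
quasi-convexity `V` contains every point at which all its members are at most 1/4 in norm; so `V` is
a neighbourhood of zero for the given topology.

Finiteness: an infinite compact Hausdorff `X` has countably many infinite subsets `B i` such that
every continuous function on `X` oscillates little on some `B i` (`exists_countable_infinite_sets`).
By Baire one `B i` works for all `g` in a nonempty open set, finitely many translates of which cover
`G`. Two members of `B i` close on the finitely many translating elements are then close on all of
`G`, hence equal, because the circle has no small subgroups.

That the given topology is locally quasi-convex and dual to its characters follows from compactness
of the completion, whose points are separated by characters: the regular representation is faithful,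
and Gelfand theory extracts characters from it. -/

/-! ### Countable families of infinite sets in compact spaces -/

/-- A compact Hausdorff space without nonempty perfect subsets contains, if it is infinite, a
nontrivial convergent sequence. -/
theorem exists_convergent_of_scattered (X : Type*) [TopologicalSpace X] [CompactSpace X] [T2Space X]
    [Infinite X] (h : ∀ P : Set X, Perfect P → ¬ P.Nonempty) :
    ∃ (x : X) (y : ℕ → X), Function.Injective y ∧ Filter.Tendsto y Filter.atTop (𝓝 x) := by
  -- A derived set without isolated points would be perfect, and it is nonempty by compactness.
  obtain ⟨x, hx, hacc⟩ : ∃ x ∈ derivedSet (Set.univ : Set X),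
      ¬ AccPt x (Filter.principal (derivedSet (Set.univ : Set X))) := by
    by_contra! hcon
    refine h _ ⟨isClosed_derivedSet _, fun x hx => hcon x hx⟩ ?_
    obtain ⟨z, hz⟩ := (Set.infinite_univ (α := X)).exists_accPt_principal
    exact ⟨z, hz⟩
  rw [accPt_iff_nhds] at hacc
  push Not at hacc
  obtain ⟨U, hU, hUx⟩ := hacc
  obtain ⟨N, hN, hNc, hNU⟩ := exists_mem_nhds_isClosed_subset hU
  have : (𝓝[≠] x).NeBot := by simpa [mem_derivedSet, AccPt] using hx
  have hinf : N.Infinite := infinite_of_mem_nhds x hN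
  refine ⟨x, fun n => (hinf.natEmbedding N n : X),
    fun a b hab => (hinf.natEmbedding N).injective (Subtype.ext hab), ?_⟩
  rw [tendsto_nhds]
  intro O hO hxO
  -- `x` is the only accumulation point in `N`, so any injective sequence in `N` converges to it.
  have hfin : (N \ O).Finite := by
    by_contra hinf'
    obtain ⟨z, hz⟩ := Set.Infinite.exists_accPt_principal hinf'
    have hzN : z ∈ N \ O := (isClosed_iff_derivedSet_subset _).1 (hNc.sdiff hO) hz
    have : z = x := hUx z ⟨hNU hzN.1, hz.mono (Filter.principal_mono.2 (Set.subset_univ _))⟩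
    exact hzN.2 (this ▸ hxO)
  have := (hfin.preimage (f := fun n => (hinf.natEmbedding N n : X))
    (fun a _ b _ hab => (hinf.natEmbedding N).injective (Subtype.ext hab)))
  rw [← Nat.cofinite_eq_atTop, Filter.mem_cofinite]
  refine this.subset fun n hn => ⟨(hinf.natEmbedding N n).2, hn⟩

/-- In a compact space, among the closed sets that meet every member of a family of closed sets
there is a minimal one. -/
theorem exists_minimal_closed_meeting {X ι : Type*} [TopologicalSpace X] [CompactSpace X]
    {C : ι → Set X} (hC : ∀ i, IsClosed (C i)) (hne : ∀ i, (C i).Nonempty) :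
    ∃ Y : Set X, Minimal (fun Y => IsClosed Y ∧ ∀ i, (Y ∩ C i).Nonempty) Y := by
  refine zorn_superset {Y : Set X | IsClosed Y ∧ ∀ i, (Y ∩ C i).Nonempty} fun c hc hchain => ?_
  rcases c.eq_empty_or_nonempty with rfl | hcne
  · exact ⟨Set.univ, ⟨isClosed_univ, by simpa using hne⟩, by simp⟩
  refine ⟨⋂₀ c, ⟨isClosed_sInter fun Y hY => (hc hY).1, fun i => ?_⟩,
    fun s hs => Set.sInter_subset_of_mem hs⟩
  have : Nonempty c := hcne.to_subtype
  have key := IsCompact.nonempty_iInter_of_directed_nonempty_isCompact_isClosed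
    (fun Y : c => (Y : Set X) ∩ C i) ?_ (fun Y => (hc Y.2).2 i)
    (fun Y => ((hc Y.2).1.inter (hC i)).isCompact) (fun Y => (hc Y.2).1.inter (hC i))
  · obtain ⟨z, hz⟩ := key
    rw [Set.mem_iInter] at hz
    refine ⟨z, fun Y hY => (hz ⟨Y, hY⟩).1, (hz (Classical.arbitrary c)).2⟩
  · intro Y Z
    rcases hchain.total Y.2 Z.2 with h | h
    · exact ⟨Y, subset_rfl, Set.inter_subset_inter_left _ h⟩
    · exact ⟨Z, Set.inter_subset_inter_left _ h, subset_rfl⟩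

/-- A nonempty perfect subset of a compact Hausdorff space carries a binary scheme of nonempty
closed sets. -/
theorem exists_perfect_scheme {X : Type*} [TopologicalSpace X] [CompactSpace X] [T2Space X]
    {P : Set X} (hP : Perfect P) (hne : P.Nonempty) :
    ∃ C : List Bool → Set X, (∀ s, IsClosed (C s)) ∧ (∀ s, (C s).Nonempty) ∧
      (∀ b s, C (b :: s) ⊆ C s) ∧ ∀ s, Disjoint (C (true :: s)) (C (false :: s)) := by
  choose D₀ D₁ h₀ h₁ hd using fun P : {P : Set X // Perfect P ∧ P.Nonempty} =>
    P.2.1.splitting P.2.2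
  let S : List Bool → {P : Set X // Perfect P ∧ P.Nonempty} := fun s =>
    s.rec ⟨P, hP, hne⟩ fun b _ Q =>
      b.rec ⟨D₁ Q, (h₁ Q).1, (h₁ Q).2.1⟩ ⟨D₀ Q, (h₀ Q).1, (h₀ Q).2.1⟩
  refine ⟨fun s => (S s).1, fun s => (S s).2.1.closed, fun s => (S s).2.2, fun b s => ?_,
    fun s => hd (S s)⟩
  cases b
  · exact (h₁ (S s)).2.2
  · exact (h₀ (S s)).2.2

/-- One child of `s` supplies `n + 1` points by induction, the disjoint other child one more. -/
theorem infinite_inter_of_scheme {X : Type*} {C : List Bool → Set X}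
    (hsub : ∀ b s, C (b :: s) ⊆ C s) (hdisj : ∀ s, Disjoint (C (true :: s)) (C (false :: s)))
    {Y : Set X} (hY : ∀ s, (Y ∩ C s).Nonempty) (s : List Bool) : (Y ∩ C s).Infinite := by
  have key : ∀ (n : ℕ) (s : List Bool), ((n + 1 : ℕ) : ℕ∞) ≤ (Y ∩ C s).encard := by
    intro n
    induction n with
    | zero => intro s; simpa [Set.one_le_encard_iff_nonempty] using hY s
    | succ n ih =>
      intro s
      have hd : Disjoint (Y ∩ C (true :: s)) (Y ∩ C (false :: s)) :=
        (hdisj s).mono Set.inter_subset_right Set.inter_subset_right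
      calc ((n + 1 + 1 : ℕ) : ℕ∞) = ((n + 1 : ℕ) : ℕ∞) + 1 := by push_cast; rfl
        _ ≤ (Y ∩ C (true :: s)).encard + (Y ∩ C (false :: s)).encard :=
          add_le_add (ih _) (Set.one_le_encard_iff_nonempty.2 (hY _))
        _ = ((Y ∩ C (true :: s)) ∪ (Y ∩ C (false :: s))).encard :=
          (Set.encard_union_eq hd).symm
        _ ≤ (Y ∩ C s).encard := Set.encard_le_encard <| Set.union_subset
          (Set.inter_subset_inter_right _ (hsub _ _)) (Set.inter_subset_inter_right _ (hsub _ _))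
  rw [← Set.encard_eq_top_iff, ENat.eq_top_iff_forall_ge]
  exact fun n => le_trans (by exact_mod_cast Nat.le_succ n) (key n s)

/-- In an infinite compact Hausdorff space there are countably many infinite sets such that every
assignment of neighbourhoods to points has a value that contains one of them. -/
theorem exists_countable_infinite_sets (X : Type*) [TopologicalSpace X] [CompactSpace X] [T2Space X]
    [Infinite X] :
    ∃ (ι : Type) (_ : Countable ι) (B : ι → Set X), (∀ i, (B i).Infinite) ∧
      ∀ O : X → Set X, (∀ x, O x ∈ 𝓝 x) → ∃ i x, B i ⊆ O x := by
  by_cases h : ∃ P : Set X, Perfect P ∧ P.Nonempty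
  · obtain ⟨P, hP, hne⟩ := h
    obtain ⟨C, hcl, hCne, hsub, hdisj⟩ := exists_perfect_scheme hP hne
    obtain ⟨Y, hY⟩ := exists_minimal_closed_meeting hcl hCne
    refine ⟨List Bool, inferInstance, fun s => Y ∩ C s,
      infinite_inter_of_scheme hsub hdisj hY.prop.2, fun O hO => ?_⟩
    obtain ⟨y, hyY, -⟩ := hY.prop.2 []
    by_contra! hcon
    -- If no `Y ∩ C s` lay in `O y`, removing the interior of `O y` from `Y` would contradict
    -- minimality.
    have hmeet : ∀ s, (Y \ interior (O y) ∩ C s).Nonempty := fun s => by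
      obtain ⟨z, hz, hzO⟩ := Set.not_subset.1 (hcon s y)
      exact ⟨z, ⟨hz.1, fun h => hzO (interior_subset h)⟩, hz.2⟩
    have := hY.le_of_le ⟨hY.prop.1.sdiff isOpen_interior, hmeet⟩ Set.sdiff_subset hyY
    exact this.2 (mem_interior_iff_mem_nhds.2 (hO y))
  · push Not at h
    obtain ⟨x, y, hy, hlim⟩ := exists_convergent_of_scattered X
      fun P hP hne => hne.ne_empty (h P hP)
    refine ⟨ℕ, inferInstance, fun n => y '' Set.Ici n,
      fun n => (Set.Ici_infinite n).image hy.injOn, fun O hO => ?_⟩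
    obtain ⟨n, hn⟩ := Filter.mem_atTop_sets.1 (hlim (hO x))
    exact ⟨n, x, by rintro _ ⟨m, hm, rfl⟩; exact hn m hm⟩

/-! ### The circle has no small subgroups -/

/-- Twice the representative `r - round r` stays in [-1/2, 1/2], where the norm is the absolute
value. -/
theorem UnitAddCircle.norm_two_nsmul {t : UnitAddCircle} (ht : ‖t‖ ≤ 1 / 4) :
    ‖2 • t‖ = 2 * ‖t‖ := by
  obtain ⟨r, rfl⟩ := QuotientAddGroup.mk_surjective t
  have hr := UnitAddCircle.norm_eq (x := r)
  have hcoe : ((QuotientAddGroup.mk r : UnitAddCircle)) = ((r - round r : ℝ) : UnitAddCircle) := by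
    rw [AddCircle.coe_sub]
    have : ((round r : ℝ) : UnitAddCircle) = 0 := by
      rw [AddCircle.coe_eq_zero_iff]
      exact ⟨round r, by simp⟩
    rw [this, sub_zero]
  have hn : ‖(QuotientAddGroup.mk r : UnitAddCircle)‖ = |r - round r| := hr
  rw [hn] at ht ⊢
  rw [hcoe, ← AddCircle.coe_nsmul,
    (AddCircle.norm_coe_eq_abs_iff (1 : ℝ) one_ne_zero).2 (by
      rw [nsmul_eq_mul, abs_mul]; norm_num; linarith), nsmul_eq_mul, abs_mul]
  norm_num

theorem UnitAddCircle.norm_le_of_forall_two_pow_nsmul {t : UnitAddCircle} {n : ℕ}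
    (h : ∀ k ≤ n, ‖2 ^ k • t‖ ≤ 1 / 4) : ‖t‖ ≤ 1 / 4 / 2 ^ n := by
  induction n generalizing t with
  | zero => simpa using h 0 le_rfl
  | succ n ih =>
    have h0 : ‖t‖ ≤ 1 / 4 := by simpa using h 0 (Nat.zero_le _)
    have := ih (t := 2 • t) fun k hk => by
      rw [← mul_nsmul', ← pow_succ]
      exact h (k + 1) (by omega)
    rw [norm_two_nsmul h0] at this
    rw [pow_succ, ← div_div]
    linarith

theorem UnitAddCircle.eq_zero_of_forall_two_pow_nsmul {t : UnitAddCircle}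
    (h : ∀ k : ℕ, ‖2 ^ k • t‖ ≤ 1 / 4) : t = 0 := by
  rw [← norm_le_zero_iff]
  refine le_of_forall_pos_le_add fun ε hε => ?_
  obtain ⟨n, hn⟩ := exists_pow_lt_of_lt_one hε (by norm_num : (1 / 2 : ℝ) < 1)
  have := norm_le_of_forall_two_pow_nsmul (n := n) fun k _ => h k
  rw [one_div_pow] at hn
  have h2 : (1 : ℝ) / 4 / 2 ^ n ≤ 1 / 2 ^ n := by gcongr; norm_num
  linarith

/-- A homomorphism to the circle that takes small values on all of the group vanishes. -/
theorem AddMonoidHom.eq_zero_of_norm_le {G : Type*} [AddCommGroup G] {χ : G →+ UnitAddCircle}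
    (h : ∀ g, ‖χ g‖ ≤ 1 / 4) : χ = 0 := by
  ext g
  exact UnitAddCircle.eq_zero_of_forall_two_pow_nsmul fun k => by
    rw [← AddMonoidHom.map_nsmul]
    exact h _

/-- A homomorphism to the circle that takes small values on a neighbourhood of zero is
continuous. -/
theorem AddMonoidHom.continuous_of_norm_le {G : Type*} [AddCommGroup G] [TopologicalSpace G]
    [IsTopologicalAddGroup G] {χ : G →+ UnitAddCircle} {V : Set G} (hV : V ∈ 𝓝 0)
    (h : ∀ g ∈ V, ‖χ g‖ ≤ 1 / 4) : Continuous χ := by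
  refine continuous_of_continuousAt_zero χ ?_
  rw [ContinuousAt, map_zero, Metric.tendsto_nhds]
  intro ε hε
  obtain ⟨n, hn⟩ := exists_pow_lt_of_lt_one hε (by norm_num : (1 / 2 : ℝ) < 1)
  have hev : ∀ᶠ g in 𝓝 (0 : G), ∀ k ∈ Finset.range (n + 1), 2 ^ k • g ∈ V := by
    rw [Filter.eventually_all_finset]
    intro k _
    have : Filter.Tendsto (fun g : G => 2 ^ k • g) (𝓝 0) (𝓝 0) := by
      simpa using (continuous_nsmul (M := G) (2 ^ k)).tendsto 0
    exact this hV
  filter_upwards [hev] with g hg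
  rw [dist_zero_right]
  have := UnitAddCircle.norm_le_of_forall_two_pow_nsmul (t := χ g) (n := n) fun k hk => by
    rw [← AddMonoidHom.map_nsmul]
    exact h _ (hg k (Finset.mem_range.2 (by omega)))
  rw [one_div_pow] at hn
  have h2 : (1 : ℝ) / 4 / 2 ^ n ≤ 1 / 2 ^ n := by gcongr; norm_num
  linarith

/-! ### Compact sets of characters are finite -/

/-- In an infinite set of points of a totally bounded space two distinct ones are close. -/
theorem exists_ne_dist_lt_of_infinite {X ι : Type*} [Finite ι] {s : Set X} (hs : s.Infinite)
    (p : X → ι → UnitAddCircle) {ε : ℝ} (hε : 0 < ε) :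
    ∃ x ∈ s, ∃ y ∈ s, x ≠ y ∧ ∀ i, dist (p x i) (p y i) < ε := by
  have := Fintype.ofFinite ι
  obtain ⟨t, ht⟩ := isCompact_univ.elim_finite_subcover (fun z : ι → UnitAddCircle => Metric.ball z (ε / 2))
    (fun _ => Metric.isOpen_ball)
    (fun z _ => Set.mem_iUnion.2 ⟨z, Metric.mem_ball_self (half_pos hε)⟩)
  have hex : ∀ x, ∃ z ∈ t, p x ∈ Metric.ball z (ε / 2) := fun x => by
    simpa using ht (Set.mem_univ (p x))
  choose c hct hc using hex
  obtain ⟨x, hx, y, hy, hxy, hcc⟩ :=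
    hs.exists_ne_map_eq_of_mapsTo (f := c) (t := (t : Set _)) (fun x _ => hct x) t.finite_toSet
  refine ⟨x, hx, y, hy, hxy, fun i => (dist_le_pi_dist _ _ i).trans_lt ?_⟩
  have h1 := hc x
  have h2 := hc y
  rw [← hcc] at h2
  rw [Metric.mem_ball] at h1 h2
  rw [dist_comm] at h2
  linarith [dist_triangle (p x) (c x) (p y)]

/-- A pointwise compact set of continuous characters of a precompact Baire group is finite. -/
theorem finite_of_compact_characters {G X : Type*} [AddCommGroup G] [TopologicalSpace G]
    [IsTopologicalAddGroup G] [BaireSpace G] (hG : IsPrecompactGroup G)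
    [TopologicalSpace X] [CompactSpace X] [T2Space X] (φ : X → G →+ UnitAddCircle)
    (hφ : Function.Injective φ) (hcont : ∀ x, Continuous (φ x))
    (hpt : ∀ g, Continuous fun x => φ x g) : Finite X := by
  by_contra hinf
  rw [not_finite_iff_infinite] at hinf
  obtain ⟨ι, _, B, hB, hosc⟩ := exists_countable_infinite_sets X
  -- The bound 1/16 is twice the 1/32 used for the covering; with another 1/16 on the finite set `F`
  -- the total stays below 1/4.
  let E : ι → Set G := fun i => {g | ∀ x ∈ B i, ∀ y ∈ B i, ‖φ x g - φ y g‖ ≤ 1 / 16}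
  have hEc : ∀ i, IsClosed (E i) := fun i => by
    simp only [E, Set.ofPred_forall]
    refine isClosed_iInter fun x => isClosed_iInter fun _ => isClosed_iInter fun y =>
      isClosed_iInter fun _ => ?_
    exact isClosed_le ((hcont x).sub (hcont y)).norm continuous_const
  have hEU : ⋃ i, E i = Set.univ := by
    refine Set.eq_univ_of_forall fun g => ?_
    obtain ⟨i, z, hz⟩ := hosc (fun x => {y | ‖φ y g - φ x g‖ < 1 / 32}) fun x => by
      refine IsOpen.mem_nhds ?_ (by simp)
      exact isOpen_lt ((hpt g).sub continuous_const).norm continuous_const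
    refine Set.mem_iUnion.2 ⟨i, fun x hx y hy => ?_⟩
    have h1 : ‖φ x g - φ z g‖ < 1 / 32 := hz hx
    have h2 : ‖φ y g - φ z g‖ < 1 / 32 := hz hy
    calc ‖φ x g - φ y g‖ = ‖(φ x g - φ z g) - (φ y g - φ z g)‖ := by congr 1; abel
      _ ≤ ‖φ x g - φ z g‖ + ‖φ y g - φ z g‖ := norm_sub_le _ _
      _ ≤ 1 / 16 := by linarith
  obtain ⟨i, hi⟩ := nonempty_interior_of_iUnion_of_closed hEc hEU
  obtain ⟨F, hF, hFU⟩ := hG _ isOpen_interior hi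
  have := hF.to_subtype
  obtain ⟨x, hx, y, hy, hxy, hd⟩ :=
    exists_ne_dist_lt_of_infinite (hB i) (fun x (f : F) => φ x f) (by norm_num : (0 : ℝ) < 1 / 16)
  refine hxy (hφ (sub_eq_zero.1 (AddMonoidHom.eq_zero_of_norm_le fun g => ?_)))
  obtain ⟨f, hf, u, hu, rfl⟩ : g ∈ F + interior (E i) := hFU ▸ Set.mem_univ g
  have h1 := hd ⟨f, hf⟩
  have h2 := interior_subset hu x hx y hy
  rw [dist_eq_norm] at h1
  calc ‖(φ x - φ y) (f + u)‖ = ‖(φ x f - φ y f) + (φ x u - φ y u)‖ := by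
        simp only [AddMonoidHom.sub_apply, map_add]
    _ ≤ ‖φ x f - φ y f‖ + ‖φ x u - φ y u‖ := norm_add_le _ _
    _ ≤ 1 / 4 := by linarith

/-! ### Characters from unitary representations -/

/-- The elements of a commutative closed star subalgebra of a C⋆-algebra are separated from zero by
contractive characters. -/
theorem StarSubalgebra.exists_character_ne_zero {A : Type*} [CStarAlgebra A]
    (B : StarSubalgebra ℂ A) (hB : IsClosed (B : Set A)) (hcomm : ∀ x y : B, x * y = y * x)
    {a : B} (ha : a ≠ 0) :
    ∃ φ : B →ₐ[ℂ] ℂ, (∀ b, ‖φ b‖ ≤ ‖b‖) ∧ φ a ≠ 0 := by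
  have : IsClosed (B : Set A) := hB
  let _ : CommCStarAlgebra B := { (inferInstance : CStarAlgebra B) with mul_comm := hcomm }
  have : Nontrivial B := ⟨a, 0, ha⟩
  have hne : WeakDual.gelfandTransform ℂ B a ≠ 0 := fun h =>
    ha ((gelfandTransform_isometry B).injective (h.trans (map_zero _).symm))
  obtain ⟨φ, hφ⟩ : ∃ φ, WeakDual.gelfandTransform ℂ B a φ ≠ 0 := by
    by_contra! hcon
    exact hne (ContinuousMap.ext hcon)
  exact ⟨WeakDual.CharacterSpace.toAlgHom φ,
    fun b => AlgHom.norm_apply_le_self (WeakDual.CharacterSpace.toAlgHom φ) b, hφ⟩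

/-- Pairwise commuting elements that commute with each other's adjoints lie in a commutative closed
star subalgebra. -/
theorem exists_closed_commutative_starSubalgebra {A : Type*} [CStarAlgebra A] {S : Set A}
    (hS : ∀ a ∈ S, ∀ b ∈ S, a * b = b * a) (hS' : ∀ a ∈ S, ∀ b ∈ S, a * star b = star b * a) :
    ∃ B : StarSubalgebra ℂ A, IsClosed (B : Set A) ∧ S ⊆ B ∧ ∀ x y : B, x * y = y * x := by
  have := StarAlgebra.isMulCommutative_adjoin ℂ hS hS'
  refine ⟨(StarAlgebra.adjoin ℂ S).topologicalClosure,
    StarSubalgebra.isClosed_topologicalClosure _,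
    (StarAlgebra.subset_adjoin ℂ S).trans (StarSubalgebra.le_topologicalClosure _),
    (StarSubalgebra.commRingTopologicalClosure (StarAlgebra.adjoin ℂ S)
      fun x y => this.is_comm.comm x y).mul_comm⟩

/-- A strongly continuous unitary representation of an abelian topological group. -/
structure UnitaryRep (K H : Type*) [AddCommGroup K] [TopologicalSpace K] [NormedAddCommGroup H]
    [InnerProductSpace ℂ H] where
  /-- The operator by which an element acts. -/
  op : K → H →L[ℂ] H
  op_zero : op 0 = 1
  op_add : ∀ x y, op (x + y) = op x * op y
  norm_op : ∀ x v, ‖op x v‖ = ‖v‖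
  continuous_op : ∀ v, Continuous fun x => op x v

namespace UnitaryRep

open MeasureTheory

variable {K H : Type*} [AddCommGroup K] [TopologicalSpace K] [NormedAddCommGroup H]
  [InnerProductSpace ℂ H] (U : UnitaryRep K H)

theorem op_commute (x y : K) : U.op x * U.op y = U.op y * U.op x := by
  rw [← op_add, ← op_add, add_comm]

theorem norm_op_le (x : K) : ‖U.op x‖ ≤ 1 :=
  ContinuousLinearMap.opNorm_le_bound _ zero_le_one fun v => by rw [U.norm_op, one_mul]

theorem star_op [CompleteSpace H] (x : K) : star (U.op x) = U.op (-x) := by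
  have h1 : star (U.op x) * U.op x = 1 :=
    (ContinuousLinearMap.norm_map_iff_adjoint_comp_self (U.op x)).1 (U.norm_op x)
  calc star (U.op x) = star (U.op x) * (U.op x * U.op (-x)) := by
        rw [← op_add, add_neg_cancel, op_zero, mul_one]
    _ = U.op (-x) := by rw [← mul_assoc, h1, one_mul]

variable [CompactSpace K] [MeasurableSpace K] (μ : Measure K) [IsFiniteMeasure μ]

theorem integrable_smul_op [BorelSpace K] (f : C(K, ℂ)) (v : H) : Integrable (fun y => f y • U.op y v) μ :=
  (f.continuous.smul (U.continuous_op v)).integrable_of_hasCompactSupport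
    (HasCompactSupport.of_compactSpace _)

theorem norm_integral_le (f : C(K, ℂ)) (v : H) :
    ‖∫ y, f y • U.op y v ∂μ‖ ≤ ‖f‖ * μ.real Set.univ * ‖v‖ := by
  refine (norm_integral_le_of_norm_le_const (C := ‖f‖ * ‖v‖) (.of_forall fun y => ?_)).trans_eq
    (by ring)
  rw [norm_smul, U.norm_op]
  gcongr
  exact f.norm_coe_le_norm y

variable [BorelSpace K]

/-- The operator obtained by integrating a representation against a continuous function. -/
noncomputable def integralOp (f : C(K, ℂ)) : H →L[ℂ] H :=
  LinearMap.mkContinuous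
    { toFun := fun v => ∫ y, f y • U.op y v ∂μ
      map_add' := fun v w => by
        simp only [map_add, smul_add]
        exact integral_add (U.integrable_smul_op μ f v) (U.integrable_smul_op μ f w)
      map_smul' := fun c v => by
        simp only [map_smul, smul_comm _ c]
        exact integral_smul c _ }
    (‖f‖ * μ.real Set.univ) (U.norm_integral_le μ f)

theorem integralOp_apply (f : C(K, ℂ)) (v : H) :
    U.integralOp μ f v = ∫ y, f y • U.op y v ∂μ := rfl

theorem integralOp_sub (f g : C(K, ℂ)) :
    U.integralOp μ (f - g) = U.integralOp μ f - U.integralOp μ g := by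
  ext v
  simp only [integralOp_apply, sub_apply, ContinuousMap.sub_apply, sub_smul]
  exact integral_sub (U.integrable_smul_op μ f v) (U.integrable_smul_op μ g v)

theorem continuous_integralOp : Continuous (U.integralOp μ) := by
  refine (LipschitzWith.of_dist_le_mul (K := (μ.real Set.univ).toNNReal) fun f g => ?_).continuous
  rw [dist_eq_norm, dist_eq_norm, ← integralOp_sub, Real.coe_toNNReal _ measureReal_nonneg,
    mul_comm]
  exact LinearMap.mkContinuous_norm_le _ (by positivity) _

theorem integralOp_mul_op [IsTopologicalAddGroup K] [μ.IsAddRightInvariant] (f : C(K, ℂ)) (x : K) :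
    U.integralOp μ f * U.op x = U.integralOp μ (f.comp ⟨fun y => y - x, by fun_prop⟩) := by
  ext v
  rw [mul_apply_eq_comp, integralOp_apply, integralOp_apply,
    ← integral_add_right_eq_self (fun y => (f.comp ⟨fun y => y - x, _⟩) y • U.op y v) x]
  refine integral_congr_ae (.of_forall fun y => ?_)
  simp [op_add]

/-- Smoothing by `f` upgrades strong continuity to norm continuity: translates of `f` vary
continuously in the uniform norm. -/
theorem continuous_integralOp_mul_op [IsTopologicalAddGroup K] [μ.IsAddRightInvariant] (f : C(K, ℂ)) :
    Continuous fun x => U.integralOp μ f * U.op x := by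
  simp only [integralOp_mul_op]
  refine (U.continuous_integralOp μ).comp ?_
  exact (ContinuousMap.curry ⟨fun p : K × K => f (p.2 - p.1), by fun_prop⟩).continuous

variable [CompleteSpace H]

theorem commute_integralOp {A : H →L[ℂ] H} (hA : ∀ x, A * U.op x = U.op x * A) (f : C(K, ℂ)) :
    A * U.integralOp μ f = U.integralOp μ f * A := by
  ext v
  simp only [mul_apply_eq_comp, integralOp_apply]
  rw [← A.integral_comp_comm (U.integrable_smul_op μ f v)]
  refine integral_congr_ae (.of_forall fun y => ?_)
  simpa using congrArg (fun T : H →L[ℂ] H => f y • T v) (hA y)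

theorem op_integralOp (x : K) (f : C(K, ℂ)) :
    U.op x * U.integralOp μ f = U.integralOp μ f * U.op x :=
  U.commute_integralOp μ (U.op_commute x) f

theorem star_integralOp_op (x : K) (f : C(K, ℂ)) :
    star (U.integralOp μ f) * U.op x = U.op x * star (U.integralOp μ f) := by
  have := congrArg star (U.op_integralOp μ (-x) f)
  rwa [star_mul, star_mul, star_op, neg_neg] at this

theorem eq_zero_of_integralOp [μ.IsOpenPosMeasure] {w : H} (h : ∀ f, U.integralOp μ f w = 0) :
    w = 0 := by
  -- Testing against the conjugate of the matrix coefficient `g` gives a vanishing integral of `‖g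
  -- y‖ ^ 2`; full support forces `g = 0`, and `g 0 = ⟪w, w⟫`.
  let g : C(K, ℂ) := ⟨fun y => inner ℂ w (U.op y w), continuous_const.inner (U.continuous_op w)⟩
  have h1 : inner ℂ w (U.integralOp μ (star g) w) = 0 := by rw [h, inner_zero_right]
  rw [integralOp_apply, ← integral_inner (U.integrable_smul_op μ _ w)] at h1
  have h2 : ∀ y, inner ℂ w ((star g) y • U.op y w) = ((‖g y‖ ^ 2 : ℝ) : ℂ) := fun y => by
    rw [inner_smul_right]
    change (starRingEnd ℂ) (g y) * g y = _
    rw [Complex.conj_mul']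
    push_cast
    rfl
  simp only [h2] at h1
  rw [integral_complex_ofReal, Complex.ofReal_eq_zero] at h1
  have hc : Continuous fun y => ‖g y‖ ^ 2 := by fun_prop
  rw [integral_eq_zero_iff_of_nonneg (fun y => by positivity)
    (hc.integrable_of_hasCompactSupport (HasCompactSupport.of_compactSpace _))] at h1
  have h3 := (hc.ae_eq_iff_eq μ continuous_const).1 h1
  have h4 : g 0 = 0 := norm_eq_zero.1 ((pow_eq_zero_iff two_ne_zero).1 (congrFun h3 0))
  simpa [g, U.op_zero] using h4

/-- If an element acts nontrivially in a unitary representation of a compact abelian group, then it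
is separated from zero by a continuous character. -/
theorem exists_circle_character [IsTopologicalAddGroup K] [μ.IsAddRightInvariant] [μ.IsOpenPosMeasure] {x : K}
    (hx : U.op x ≠ 1) :
    ∃ χ : K → Circle, Continuous χ ∧ (∀ y z, χ (y + z) = χ y * χ z) ∧ χ x ≠ 1 := by
  obtain ⟨v, hv⟩ : ∃ v, U.op x v - v ≠ 0 := by
    by_contra! hcon
    exact hx (ContinuousLinearMap.ext fun v => sub_eq_zero.1 (hcon v))
  obtain ⟨f, hf⟩ : ∃ f, U.integralOp μ f (U.op x v - v) ≠ 0 := by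
    by_contra! hcon
    exact hv (U.eq_zero_of_integralOp μ hcon)
  obtain ⟨B, hBc, hSB, hB⟩ := exists_closed_commutative_starSubalgebra
    (S := insert (U.integralOp μ f) (Set.range U.op)) (by
      rintro _ (rfl | ⟨y, rfl⟩) _ (rfl | ⟨z, rfl⟩)
      · rfl
      · exact (U.op_integralOp μ z f).symm
      · exact U.op_integralOp μ y f
      · exact U.op_commute y z) (by
      rintro _ (rfl | ⟨y, rfl⟩) _ (rfl | ⟨z, rfl⟩)
      · exact (U.commute_integralOp μ (U.star_integralOp_op μ · f) f).symm
      · rw [star_op]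
        exact (U.op_integralOp μ (-z) f).symm
      · exact (U.star_integralOp_op μ y f).symm
      · rw [star_op]
        exact U.op_commute y (-z))
  let T : B := ⟨U.integralOp μ f, hSB (Set.mem_insert _ _)⟩
  let u : K → B := fun y => ⟨U.op y, hSB (Set.mem_insert_of_mem _ ⟨y, rfl⟩)⟩
  have hu0 : u 0 = 1 := Subtype.ext U.op_zero
  have hu : ∀ y z, u (y + z) = u y * u z := fun y z => Subtype.ext (U.op_add y z)
  have hne : T * (u x - 1) ≠ 0 := fun h =>
    hf (by simpa [T, u] using congrArg (fun b : B => (b : H →L[ℂ] H) v) h)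
  obtain ⟨φ, hφ, hφT⟩ := B.exists_character_ne_zero hBc hB hne
  rw [map_mul, map_sub, map_one] at hφT
  have hle : ∀ y, ‖φ (u y)‖ ≤ 1 := fun y => (hφ _).trans (U.norm_op_le y)
  have hmul : ∀ y, φ (u y) * φ (u (-y)) = 1 := fun y => by
    rw [← map_mul, ← hu, add_neg_cancel, hu0, map_one]
  -- Two numbers of norm at most 1 with product of norm 1.
  have hnorm : ∀ y, ‖φ (u y)‖ = 1 := fun y => by
    have h1 : ‖φ (u y)‖ * ‖φ (u (-y))‖ = 1 := by rw [← norm_mul, hmul, norm_one]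
    nlinarith [hle y, hle (-y), norm_nonneg (φ (u y)), norm_nonneg (φ (u (-y)))]
  have hφc : Continuous φ :=
    AddMonoidHomClass.continuous_of_bound φ 1 fun b => by simpa using hφ b
  have hc : Continuous fun y => φ (u y) := by
    -- `u` itself need not be norm continuous, but `T * u y` is, and `φ T ≠ 0` can be divided out.
    have h1 : Continuous fun y => T * u y :=
      Continuous.subtype_mk (U.continuous_integralOp_mul_op μ f) _
    have h2 : (fun y => φ (u y)) = fun y => φ (T * u y) / φ T := by
      ext y
      rw [map_mul, mul_div_cancel_left₀ _ (left_ne_zero_of_mul hφT)]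
    rw [h2]
    exact (hφc.comp h1).div_const _
  refine ⟨fun y => ⟨φ (u y), mem_sphere_zero_iff_norm.2 (hnorm y)⟩, hc.subtype_mk _,
    fun y z => Subtype.ext ?_, fun h => ?_⟩
  · exact (congrArg φ (hu y z)).trans (map_mul φ _ _)
  · exact right_ne_zero_of_mul hφT (sub_eq_zero.2 (congrArg Subtype.val h))

end UnitaryRep

/-! ### Compact groups: characters separate points -/

section Regular

open MeasureTheory

variable (K : Type*) [AddCommGroup K] [TopologicalSpace K] [IsTopologicalAddGroup K]
  [CompactSpace K] [T2Space K] [MeasurableSpace K] [BorelSpace K] (μ : Measure K)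
  [μ.IsAddLeftInvariant] [μ.IsOpenPosMeasure] [μ.Regular]

/-- The regular representation of a compact abelian group. -/
noncomputable def regularRep : UnitaryRep K (Lp ℂ 2 μ) where
  op x := LinearMap.mkContinuous
    { toFun := fun v => DomAddAct.mk x +ᵥ v
      map_add' := fun v w => DomAddAct.vadd_Lp_add _ v w
      map_smul' := fun c v => Subtype.ext (by rcases v with ⟨⟨_⟩, _⟩; rfl) }
    1 fun v => by simp
  op_zero := by
    ext1 v
    simp
  op_add x y := by
    ext1 v
    simp [add_comm x y, add_vadd]
  norm_op x v := DomAddAct.norm_vadd_Lp _ v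
  continuous_op v := by
    have : Fact ((2 : ENNReal) ≠ ⊤) := ⟨by simp⟩
    exact DomAddAct.continuous_mk.vadd continuous_const

theorem regularRep_op_ne_one {x : K} (hx : x ≠ 0) : (regularRep K μ).op x ≠ 1 := by
  -- A Urysohn function differing at `0` and `x` is moved by translation; full support of `μ` turns
  -- equality in L² into equality everywhere.
  obtain ⟨f, hf0, hf1, -⟩ := exists_continuous_zero_one_of_isClosed
    (isClosed_singleton (x := (0 : K))) (isClosed_singleton (x := x)) (by simpa using hx.symm)
  have hc : Continuous fun y => (f y : ℂ) := by fun_prop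
  have hm : MemLp (fun y => (f y : ℂ)) 2 μ :=
    hc.memLp_of_hasCompactSupport (HasCompactSupport.of_compactSpace _)
  intro h
  have h1 : (regularRep K μ).op x (hm.toLp _) = hm.toLp _ := by rw [h]; rfl
  have h2 : (hm.comp_measurePreserving (measurePreserving_vadd x μ)).toLp _ = hm.toLp _ := h1
  rw [MemLp.toLp_eq_toLp_iff] at h2
  have h3 := ((hc.comp (continuous_const_vadd x)).ae_eq_iff_eq μ hc).1 h2
  have h4 := congrFun h3 0
  have h5 : f 0 = 0 := hf0 rfl
  have h6 : f x = 1 := hf1 rfl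
  simp [h5, h6] at h4

end Regular

/-- The continuous characters of a compact Hausdorff abelian group separate its points. -/
theorem exists_character_ne_zero_of_compact {K : Type*} [AddCommGroup K] [TopologicalSpace K]
    [IsTopologicalAddGroup K] [CompactSpace K] [T2Space K] {x : K} (hx : x ≠ 0) :
    ∃ χ : K →ₜ+ UnitAddCircle, χ x ≠ 0 := by
  borelize K
  let μ : MeasureTheory.Measure K := MeasureTheory.Measure.addHaar
  obtain ⟨ψ, hψ, hadd, hne⟩ :=
    (regularRep K μ).exists_circle_character μ (regularRep_op_ne_one K μ hx)
  let e := AddCircle.homeomorphCircle (T := 1) one_ne_zero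
  have he : ∀ a b, e (a + b) = e a * e b := fun a b => by
    simp only [e, AddCircle.homeomorphCircle_apply, AddCircle.toCircle_add]
  refine ⟨ContinuousAddMonoidHom.mk (AddMonoidHom.mk' (fun y => e.symm (ψ y)) fun y z =>
    e.injective (by rw [he]; simp [hadd])) (e.symm.continuous.comp hψ), fun h => hne ?_⟩
  have h0 : e 0 = 1 := by simp [e, AddCircle.homeomorphCircle_apply]
  have h1 : e.symm (ψ x) = 0 := h
  rw [← h0, ← h1, e.apply_symm_apply]

/-- Finitely many continuous characters of a compact Hausdorff abelian group determine a
neighbourhood of zero inside a given one. -/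
theorem exists_finset_characters_of_compact {K : Type*} [AddCommGroup K] [TopologicalSpace K]
    [IsTopologicalAddGroup K] [CompactSpace K] [T2Space K] {W : Set K} (hW : W ∈ 𝓝 0) :
    ∃ F : Finset (K →ₜ+ UnitAddCircle), {z | ∀ χ ∈ F, ‖χ z‖ ≤ 1 / 4} ⊆ W := by
  obtain ⟨t, ht⟩ := (isOpen_interior (s := W)).isClosed_compl.isCompact.elim_finite_subcover
    (fun χ : K →ₜ+ UnitAddCircle => {z | 1 / 4 < ‖χ z‖})
    (fun χ => isOpen_lt continuous_const χ.continuous_toFun.norm) (fun z hz => by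
      have hz0 : z ≠ 0 := fun h => hz (h ▸ mem_interior_iff_mem_nhds.2 hW)
      obtain ⟨χ, hχ⟩ := exists_character_ne_zero_of_compact hz0
      -- Repeated doubling makes a nonzero value leave the arc of radius 1/4.
      obtain ⟨k, hk⟩ : ∃ k : ℕ, 1 / 4 < ‖2 ^ k • χ z‖ := by
        by_contra! hcon
        exact hχ (UnitAddCircle.eq_zero_of_forall_two_pow_nsmul hcon)
      have hmap : (2 ^ k • χ) z = 2 ^ k • χ z := AddMonoidHom.map_nsmul (evalPairing K z) (2 ^ k) χ
      exact Set.mem_iUnion.2 ⟨2 ^ k • χ, by rwa [← hmap] at hk⟩)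
  refine ⟨t, fun z hz => ?_⟩
  by_contra hzW
  obtain ⟨χ, hχ, hlt⟩ := Set.mem_iUnion₂.1 (ht fun h => hzW (interior_subset h))
  exact absurd hlt (not_lt.2 (hz χ hχ))

/-! ### Precompact groups carry the topology of their characters -/

theorem IsPrecompactGroup.totallyBounded_univ {G : Type*} [AddCommGroup G] [UniformSpace G]
    [IsUniformAddGroup G] (hG : IsPrecompactGroup G) : TotallyBounded (Set.univ : Set G) := by
  rw [totallyBounded_iff_subset_finite_iUnion_nhds_zero]
  intro U hU
  obtain ⟨F, hF, hFU⟩ := hG (interior U) isOpen_interior ⟨0, mem_interior_iff_mem_nhds.2 hU⟩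
  refine ⟨F, hF, fun g _ => ?_⟩
  obtain ⟨f, hf, u, hu, rfl⟩ : g ∈ F + interior U := hFU ▸ Set.mem_univ g
  exact Set.mem_iUnion₂.2 ⟨f, hf, u, interior_subset hu, rfl⟩

theorem UniformSpace.Completion.compactSpace_of_totallyBounded {X : Type*} [UniformSpace X]
    (h : TotallyBounded (Set.univ : Set X)) : CompactSpace (UniformSpace.Completion X) := by
  refine isCompact_univ_iff.1 (isCompact_iff_totallyBounded_isComplete.2 ⟨?_, isComplete_univ⟩)
  rw [← UniformSpace.Completion.denseRange_coe.closure_range, ← Set.image_univ]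
  exact (h.image (UniformSpace.Completion.uniformContinuous_coe X)).closure

theorem exists_finset_characters_comap {G K : Type*} [AddCommGroup G] [TopologicalSpace G]
    [AddCommGroup K] [TopologicalSpace K] (ι : G →ₜ+ K) (F : Finset (K →ₜ+ UnitAddCircle)) :
    ∃ F' : Finset (G →ₜ+ UnitAddCircle),
      {g | ∀ χ ∈ F', ‖χ g‖ ≤ 1 / 4} ⊆ {g | ∀ χ ∈ F, ‖χ (ι g)‖ ≤ 1 / 4} := by
  classical
  refine ⟨F.image fun χ => χ.comp ι, fun g hg χ hχ => ?_⟩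
  have h : ‖(χ.comp ι) g‖ ≤ 1 / 4 := hg (χ.comp ι) (Finset.mem_image_of_mem _ hχ)
  rwa [ContinuousAddMonoidHom.comp_toFun] at h

/-- The topology of a precompact group is induced by its continuous characters. -/
theorem IsPrecompactGroup.exists_finset_characters {G : Type*} [AddCommGroup G]
    [TopologicalSpace G] [IsTopologicalAddGroup G] (hG : IsPrecompactGroup G) {U : Set G}
    (hU : U ∈ 𝓝 0) :
    ∃ F : Finset (G →ₜ+ UnitAddCircle), {g | ∀ χ ∈ F, ‖χ g‖ ≤ 1 / 4} ⊆ U := by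
  let _ : UniformSpace G := IsTopologicalAddGroup.rightUniformSpace G
  have : IsUniformAddGroup G := isUniformAddGroup_of_addCommGroup
  have := UniformSpace.Completion.compactSpace_of_totallyBounded hG.totallyBounded_univ
  obtain ⟨W, hW, hWU⟩ : ∃ W ∈ 𝓝 (0 : UniformSpace.Completion G), (↑) ⁻¹' W ⊆ U := by
    have := (UniformSpace.Completion.isUniformInducing_coe G).isInducing.nhds_eq_comap (0 : G)
    rw [this, UniformSpace.Completion.coe_zero] at hU
    exact hU
  obtain ⟨t, ht⟩ := exists_finset_characters_of_compact hW
  let ι : G →ₜ+ UniformSpace.Completion G :=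
    { toAddMonoidHom := UniformSpace.Completion.toCompl
      continuous_toFun := UniformSpace.Completion.continuous_coe G }
  obtain ⟨F, hF⟩ := exists_finset_characters_comap ι t
  exact ⟨F, fun g hg => hWU (ht (hF hg))⟩

theorem isQuasiConvex_setOf_forall_le {G : Type*} [AddCommGroup G] [TopologicalSpace G]
    (F : Finset (G →ₜ+ UnitAddCircle)) : IsQuasiConvex {g | ∀ χ ∈ F, ‖χ g‖ ≤ 1 / 4} := by
  intro x hx
  simp only [Set.mem_ofPred_eq, not_forall, not_le] at hx
  obtain ⟨χ, hχ, hlt⟩ := hx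
  exact ⟨χ, fun a ha => ha χ hχ, hlt⟩

theorem setOf_forall_le_mem_nhds {G : Type*} [AddCommGroup G] [TopologicalSpace G]
    (F : Finset (G →ₜ+ UnitAddCircle)) : {g | ∀ χ ∈ F, ‖χ g‖ ≤ 1 / 4} ∈ 𝓝 (0 : G) := by
  refine (Filter.eventually_all_finset F).2 fun χ _ => ?_
  have h := χ.continuous_toFun.norm.tendsto 0
  have h0 : ‖χ.toFun 0‖ < 1 / 4 := by
    change ‖χ 0‖ < 1 / 4
    rw [map_zero, norm_zero]
    norm_num
  exact (h.eventually (gt_mem_nhds h0)).mono fun g hg => le_of_lt hg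

theorem IsPrecompactGroup.isLocallyQuasiConvex {G : Type*} [AddCommGroup G] [TopologicalSpace G]
    [IsTopologicalAddGroup G] (hG : IsPrecompactGroup G) : IsLocallyQuasiConvex G := by
  intro U hU
  obtain ⟨F, hF⟩ := hG.exists_finset_characters hU
  exact ⟨_, setOf_forall_le_mem_nhds F, hF, isQuasiConvex_setOf_forall_le F⟩

theorem IsPrecompactGroup.isGroupDuality {G : Type*} [AddCommGroup G] [TopologicalSpace G]
    [IsTopologicalAddGroup G] [T2Space G] (hG : IsPrecompactGroup G) :
    IsGroupDuality (evalPairing G) where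
  left g hg := by
    by_contra! hcon
    obtain ⟨F, hF⟩ := hG.exists_finset_characters (isOpen_compl_singleton.mem_nhds hg.symm)
    refine hF (fun χ _ => ?_) rfl
    have : χ g = 0 := hcon χ
    rw [this, norm_zero]
    norm_num
  right χ hχ := by
    by_contra! hcon
    exact hχ (ContinuousAddMonoidHom.ext hcon)

/-! ### Polars and the Mackey property -/

/-- The polar of a set, as a set of homomorphisms to the circle. -/
def characterPolar {G : Type*} [AddCommGroup G] (V : Set G) : Set (G → UnitAddCircle) :=
  {f | (∀ g h, f (g + h) = f g + f h) ∧ ∀ v ∈ V, ‖f v‖ ≤ 1 / 4}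

theorem IsQuasiConvex.exists_mem_characterPolar {G : Type*} [AddCommGroup G] [TopologicalSpace G]
    {V : Set G} (hV : IsQuasiConvex V) {x : G} (hx : x ∉ V) :
    ∃ f ∈ characterPolar V, 1 / 4 < ‖f x‖ := by
  obtain ⟨χ, hχ, hlt⟩ := hV x hx
  exact ⟨χ, ⟨fun a b => map_add χ a b, hχ⟩, hlt⟩

/-- As no continuity is imposed on its members, the polar is cut out by pointwise closed conditions;
it is thus compact in the product of circles. -/
theorem isClosed_characterPolar {G : Type*} [AddCommGroup G] (V : Set G) :
    IsClosed (characterPolar V) := by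
  have h : characterPolar V = (⋂ g, ⋂ h, {f | f (g + h) = f g + f h}) ∩
      ⋂ v ∈ V, {f | ‖f v‖ ≤ 1 / 4} := by
    ext f
    simp [characterPolar]
  rw [h]
  refine (isClosed_iInter fun g => isClosed_iInter fun h => ?_).inter
    (isClosed_iInter fun v => isClosed_iInter fun _ => ?_)
  · exact isClosed_eq (continuous_apply _) ((continuous_apply g).add (continuous_apply h))
  · exact isClosed_le (continuous_apply v).norm continuous_const

/-- In a precompact Baire group, a set whose polar consists of continuous characters has a finite
polar. -/
theorem IsPrecompactGroup.finite_characterPolar {G : Type*} [AddCommGroup G] [TopologicalSpace G]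
    [IsTopologicalAddGroup G] [BaireSpace G] (hG : IsPrecompactGroup G) {V : Set G}
    (hV : ∀ f ∈ characterPolar V, Continuous f) : (characterPolar V).Finite := by
  have : CompactSpace (characterPolar V) :=
    isCompact_iff_compactSpace.1 (isClosed_characterPolar V).isCompact
  have := finite_of_compact_characters hG (X := characterPolar V)
    (fun f => AddMonoidHom.mk' f.1 f.2.1)
    (fun f f' h => Subtype.ext (congrArg DFunLike.coe h)) (fun f => hV f.1 f.2)
    (fun g => (continuous_apply g).comp continuous_subtype_val)
  exact Set.toFinite _

/-- A quasi-convex neighbourhood of zero for a group topology with the same continuous characters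
as a precompact Baire topology is a neighbourhood of zero for the latter. -/
theorem IsPrecompactGroup.mem_nhds_of_isQuasiConvex {G : Type*} [AddCommGroup G]
    {t : TopologicalSpace G} [TopologicalSpace G] [IsTopologicalAddGroup G] [BaireSpace G]
    (hG : IsPrecompactGroup G) (ht : @IsTopologicalAddGroup G t _)
    (hcomp : IsCompatibleTopology (evalPairing G) t) {V : Set G} (hV : V ∈ @nhds G t 0)
    (hqc : @IsQuasiConvex G _ t V) : V ∈ 𝓝 (0 : G) := by
  have hcont : ∀ χ : G →+ UnitAddCircle, Continuous[t, inferInstance] χ → Continuous χ := by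
    intro χ hχ
    obtain ⟨ψ, hψ⟩ := (hcomp χ).1 hχ
    have h : (χ : G → UnitAddCircle) = ψ := funext hψ
    rw [h]
    exact ψ.continuous_toFun
  have hcontP : ∀ f ∈ characterPolar V, Continuous f := fun f hf =>
    hcont (AddMonoidHom.mk' f hf.1)
      (@AddMonoidHom.continuous_of_norm_le G _ t ht (AddMonoidHom.mk' f hf.1) V hV hf.2)
  have hfin := hG.finite_characterPolar hcontP
  have hmem : ∀ᶠ g in 𝓝 (0 : G), ∀ f ∈ characterPolar V, ‖f g‖ ≤ 1 / 4 := by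
    rw [Filter.eventually_all_finite hfin]
    intro f hf
    have h0 : ‖f 0‖ < 1 / 4 := by
      have : f 0 = 0 := (AddMonoidHom.mk' f hf.1).map_zero
      rw [this, norm_zero]
      norm_num
    exact ((hcontP f hf).norm.tendsto 0 |>.eventually (gt_mem_nhds h0)).mono fun g hg => le_of_lt hg
  filter_upwards [hmem] with g hg
  by_contra hgV
  obtain ⟨f, hf, hlt⟩ := @IsQuasiConvex.exists_mem_characterPolar G _ t V hqc g hgV
  exact absurd hlt (not_lt.2 (hg f hf))

theorem corollary3p5 {G : Type*} [AddCommGroup G] [TopologicalSpace G] [IsTopologicalAddGroup G]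
    [T2Space G] [BaireSpace G] (hG : IsPrecompactGroup G) : IsMackeyGroup G where
  hausdorff := inferInstance
  locallyQuasiConvex := hG.isLocallyQuasiConvex
  duality := hG.isGroupDuality
  finest := by
    refine ⟨⟨fun χ => ⟨fun h => ⟨⟨χ, h⟩, fun _ => rfl⟩, ?_⟩, hG.isLocallyQuasiConvex⟩, ?_⟩
    · rintro ⟨ψ, hψ⟩
      have h : (χ : G → UnitAddCircle) = ψ := funext hψ
      rw [h]
      exact ψ.continuous_toFun
    · rintro t ⟨hcomp, hlqc⟩
      have hT := t.toIsTopologicalAddGroup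
      -- The given topology is finer than `t` when the identity into `(G, t)` is continuous, which
      -- for a homomorphism need only be checked at zero.
      have hid : @ContinuousAt G G _ t.toTopologicalSpace (AddMonoidHom.id G) 0 := by
        intro U hU
        obtain ⟨V, hV, hVU, hqc⟩ := hlqc U hU
        exact Filter.mem_of_superset (hG.mem_nhds_of_isQuasiConvex hT hcomp hV hqc) hVU
      exact continuous_id_iff_le.1
        (@continuous_of_continuousAt_zero G _ _ _ G (G →+ G) _ t.toTopologicalSpace _ _ _
          (AddMonoidHom.id G) hid)
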